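/- **Setting.** Let $Q\subset\mathbb R^q$ be compact and let $\mathbb P_z$ be a Borel probability measure on $\mathbb R^q$ with $\mathbb P_z(Q)=1$. Let $g_1,\dots,g_n\in\mathbb R^q$ be distinct points, let $a_1,\dots,a_n>0$ with $\sum_{i=1}^n a_i=1$, let $f:[0,\infty)\to\mathbb R$, and put $c(z,g)=f(\|z-g\|)$ ($\|\cdot\|$ the Euclidean norm). For $w\in\mathbb R^n$ define the generalized Voronoi cells $$V_i^c(w)=\{z\in\mathbb R^q:\ c(z,g_i)-w_i\le c(z,g_j)-w_j\ \text{ for all } j\in\{1,\dots,n\}\},$$ and the dual function $$h(w)=\int_Q \min_{1\le i\le n}\{c(z,g_i)-w_i\}\,\mathbb P_z(dz)+\sum_{i=1}^n a_iw_i .$$ Assume: * **A1.** For every $i$, $z\mapsto c(z,g_i)$ is bounded below and lower semicontinuous on $Q$, and $z\mapsto\max_i c(z,g_i)$ is $\mathbb P_z$-integrable on $Q$. * **A2.** For all $i\ne j$ and all $r\in\mathbb R$, $\mathbb P_z(\{z\in Q: c(z,g_i)-c(z,g_j)=r\})=0$. Let $(\gamma_k)_{k\ge0}$ be stepsizes with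 $\gamma_k\ge0$, $\sum_{k\ge 0}\gamma_k=+\infty$ and $\sum_{k\ge 0}\gamma_k^2<\infty$. Let $Z_1,Z_2,\dots$ be independent random variables, each with distribution $\mathbb P_z$ (the locations of successive events). **Algorithm (adaptive partitioning).** There are $n$ robots, which communicate over a connected undirected graph. Starting from $w_0=0\in\mathbb R^n$, when event $k\ge1$ occurs at $Z_k$ the robots run the min-consensus algorithm FloodMin from the values $\hat d_j=f(\|Z_k-g_j\|)-w_{j,k-1}$: robot $j$ starts with the record $d_j=\hat d_j$ and, in each of a fixed number (at least the diameter of the graph) of synchronous rounds, every robot replaces its record by the minimum of its own record and those of its neighbours. Then $$w_{i,k}=\begin{cases} w_{i,k-1}+\gamma_{k-1}(a_i-1) & \text{if robot } i \text{ terminates with } d_i=\hat d_i,\\ w_{i,k-1}+\gamma_{k-1}a_i & \text{otherwise.}\end{cases}$$ (The first case is the case $Z_k\in V_i^c(w_{k-1})$, so the update direction is the stochastic supergradient with components $a_i-\mathbf 1_{V_i^c(w_{k-1})}(Z_k)$.) **Theorem.** Almost surely, the sequence of weight vectors $(w_k)_{k\ge0}$ converges to some (possibly random) $w^*\in\mathbb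 R^n$ that maximizes $h$ over $\mathbb R^n$, and the resulting generalized Voronoi diagram satisfies $\mathbb P_z(V_i^c(w^*))=a_i$ for all $i=1,\dots,n$. -/

import Mathlib

open MeasureTheory ProbabilityTheory Filter Topology

noncomputable section

/-- The generalized Voronoi cell `V^c_i(p, w)` of the generator `p i` with weight `w i`, with respect
to the cost `c`. -/
def genVoronoiCell {q n : ℕ}
    (c : EuclideanSpace ℝ (Fin q) → EuclideanSpace ℝ (Fin q) → ℝ)
    (p : Fin n → EuclideanSpace ℝ (Fin q)) (w : Fin n → ℝ) (i : Fin n) :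
    Set (EuclideanSpace ℝ (Fin q)) :=
  {z | ∀ j, c z (p i) - w i ≤ c z (p j) - w j}

/-- The dual function `h(w) = ∫_Q min_i (c(z, g_i) - w_i) P_z(dz) + ∑_i a_i w_i`.
(The infimum over the finite nonempty index set is a minimum.) -/
def dualFunction {q n : ℕ}
    (c : EuclideanSpace ℝ (Fin q) → EuclideanSpace ℝ (Fin q) → ℝ)
    (g : Fin n → EuclideanSpace ℝ (Fin q)) (a : Fin n → ℝ)
    (Q : Set (EuclideanSpace ℝ (Fin q))) (Pz : Measure (EuclideanSpace ℝ (Fin q)))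
    (w : Fin n → ℝ) : ℝ :=
  (∫ z in Q, ⨅ i, (c z (g i) - w i) ∂Pz) + ∑ i, a i * w i

/-- The cost `c(z, g) = f(‖z - g‖)`, for the Euclidean norm. -/
def radialCost {q : ℕ} (f : ℝ → ℝ) (z g : EuclideanSpace ℝ (Fin q)) : ℝ :=
  f ‖z - g‖

/-- One synchronous round of `FloodMin` on the communication network `N`: every robot replaces its
record by the minimum of its own record and the records of its neighbours. -/
def floodMinRound {n : ℕ} (N : SimpleGraph (Fin n)) (d : Fin n → ℝ) : Fin n → ℝ :=
  fun i => ⨅ j : {j : Fin n // j = i ∨ N.Adj i j}, d j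

/-- The records after the given number of rounds of `FloodMin`, started from the values `dhat`. -/
def floodMin {n : ℕ} (N : SimpleGraph (Fin n)) (rounds : ℕ) (dhat : Fin n → ℝ) : Fin n → ℝ :=
  (floodMinRound N)^[rounds] dhat

open Classical in
/-- The weights produced by the adaptive partitioning algorithm along the sequence of event
locations `z` (`z k` is the location of event number `k + 1`): initially all weights vanish; at each
event the robots run `FloodMin` from the values `f(‖z - g_j‖) - w_j`, and robot `i` adds
`γ (a_i - 1)` to its weight if its record still equals its initial value, and `γ a_i` otherwise. -/
def adaptiveWeights {q n : ℕ} (N : SimpleGraph (Fin n)) (rounds : ℕ) (f : ℝ → ℝ)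
    (g : Fin n → EuclideanSpace ℝ (Fin q)) (a : Fin n → ℝ) (γ : ℕ → ℝ)
    (z : ℕ → EuclideanSpace ℝ (Fin q)) : ℕ → Fin n → ℝ
  | 0 => fun _ => 0
  | k + 1 => fun i =>
      let w := adaptiveWeights N rounds f g a γ z k
      let dhat : Fin n → ℝ := fun j => f ‖z k - g j‖ - w j
      if floodMin N rounds dhat i = dhat i then w i + γ k * (a i - 1) else w i + γ k * a i

end

/-! The algorithm is stochastic supergradient ascent on a concave function. After at least
diameter-many rounds every robot holds the global minimum, so its test detects membership of the
event in its cell (`floodMin_eq_self_iff`), and the update direction has conditional mean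
`costGrad`. Ties are null by A2, so `costGrad` is a continuous supergradient of the dual function
(`costDual_le`, `continuous_costGrad`). A maximizer exists (`exists_costDual_max`), and the
maximizers are exactly the zeros of `costGrad`, i.e. the weights whose cells have masses `a i`.

Fix a maximizer `d`. The squared distance of the iterates to `d`, plus the accumulated drift towards
`d`, minus `n * ∑ γ ^ 2`, is a supermartingale bounded below (`supermartingale_lyapunov`). Its
almost sure convergence shows that the distance to `d` converges and that the drifts weighted by `γ`
are summable. As `∑ γ` diverges, the drift tends to zero along a subsequence; the iterates are
bounded, so they have a limit point there, and it is again a maximizer. This limit point is random,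
whereas the exceptional null set depends on `d`; hence the argument runs over a countable dense set
of maximizers, whose members approximate the limit point and force the whole sequence to converge to
it (`exists_tendsto_zero_of_drift`). -/

noncomputable section

/-! ### Min-consensus on a connected graph. -/

section FloodMin

variable {n : ℕ} (N : SimpleGraph (Fin n))

theorem floodMinRound_le {d : Fin n → ℝ} {i j : Fin n} (h : j = i ∨ N.Adj i j) :
    floodMinRound N d i ≤ d j :=
  ciInf_le (f := fun k : {k : Fin n // k = i ∨ N.Adj i k} => d k)
    (Set.finite_range _).bddBelow ⟨j, h⟩

theorem le_floodMinRound {d : Fin n → ℝ} {i : Fin n} {m : ℝ} (h : ∀ j, m ≤ d j) :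
    m ≤ floodMinRound N d i :=
  haveI : Nonempty {j : Fin n // j = i ∨ N.Adj i j} := ⟨⟨i, Or.inl rfl⟩⟩
  le_ciInf fun j => h j

theorem le_floodMin {d : Fin n → ℝ} {m : ℝ} (h : ∀ j, m ≤ d j) (r : ℕ) (i : Fin n) :
    m ≤ floodMin N r d i := by
  induction r generalizing i with
  | zero => exact h i
  | succ r ih =>
    rw [floodMin, Function.iterate_succ_apply']
    exact le_floodMinRound N ih

/-- Each round carries a value across one edge; induction on the number of rounds, peeling off the
first edge of the walk. -/
theorem floodMin_le_of_walk {d : Fin n → ℝ} (r : ℕ) {i j : Fin n} (p : N.Walk i j)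
    (hp : p.length ≤ r) : floodMin N r d i ≤ d j := by
  induction r generalizing i with
  | zero =>
    obtain rfl := SimpleGraph.Walk.eq_of_length_eq_zero (Nat.le_zero.mp hp)
    exact le_rfl
  | succ r ih =>
    rw [floodMin, Function.iterate_succ_apply']
    cases p with
    | nil => exact (floodMinRound_le N (Or.inl rfl)).trans (ih SimpleGraph.Walk.nil (Nat.zero_le _))
    | cons hadj p =>
      exact (floodMinRound_le N (Or.inr hadj)).trans
        (ih p (by simpa [SimpleGraph.Walk.length_cons] using hp))

/-- A robot keeps its initial value exactly if that value is minimal. -/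
theorem floodMin_eq_self_iff (hN : N.Connected) {r : ℕ} (hr : N.diam ≤ r) (d : Fin n → ℝ)
    (i : Fin n) : floodMin N r d i = d i ↔ ∀ j, d i ≤ d j := by
  have := hN.nonempty
  constructor
  · intro h j
    obtain ⟨p, hp⟩ := hN.exists_walk_length_eq_dist i j
    rw [← h]
    exact floodMin_le_of_walk N r p (hp ▸ (SimpleGraph.dist_le_diam
      (SimpleGraph.connected_iff_ediam_ne_top.mp hN)).trans hr)
  · intro h
    exact le_antisymm (floodMin_le_of_walk N r SimpleGraph.Walk.nil (Nat.zero_le _))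
      (le_floodMin N h r i)

end FloodMin

/-! ### The dual function: supergradient, continuity, maximizers. -/

section Dual

variable {E : Type*} {n : ℕ}

/-- The cell of the index `i` for the cost vector `C` and the weights `w`. -/
def costCell (C : E → Fin n → ℝ) (w : Fin n → ℝ) (i : Fin n) : Set E :=
  {z | ∀ j, C z i - w i ≤ C z j - w j}

theorem exists_mem_costCell [NeZero n] (C : E → Fin n → ℝ) (w : Fin n → ℝ) (z : E) :
    ∃ i, z ∈ costCell C w i := by
  obtain ⟨i, hi⟩ := Finite.exists_min fun i => C z i - w i
  exact ⟨i, hi⟩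

theorem iInf_eq_of_mem_costCell {C : E → Fin n → ℝ} {w : Fin n → ℝ} {z : E} {i : Fin n}
    (h : z ∈ costCell C w i) :
    ⨅ j, (C z j - w j) = C z i - w i :=
  haveI : Nonempty (Fin n) := ⟨i⟩
  le_antisymm (ciInf_le (Set.finite_range _).bddBelow i) (le_ciInf h)

variable [MeasurableSpace E] (C : E → Fin n → ℝ) (a : Fin n → ℝ) (μ : Measure E)

/-- The dual function of the cost vector `C`. -/
def costDual (w : Fin n → ℝ) : ℝ :=
  (∫ z, ⨅ i, (C z i - w i) ∂μ) + ∑ i, a i * w i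

/-- The supergradient of the dual function. -/
def costGrad (w : Fin n → ℝ) (i : Fin n) : ℝ :=
  a i - μ.real (costCell C w i)

/-- Measurability jointly in weights and point is needed because the weights are themselves random.
-/
theorem measurableSet_costCell_joint (hC : Measurable C) (i : Fin n) :
    MeasurableSet {p : (Fin n → ℝ) × E | p.2 ∈ costCell C p.1 i} := by
  have hC' : ∀ j, Measurable fun z => C z j := fun j => (measurable_pi_apply j).comp hC
  have : {p : (Fin n → ℝ) × E | p.2 ∈ costCell C p.1 i} =
      ⋂ j, {p | C p.2 i - p.1 i ≤ C p.2 j - p.1 j} := by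
    ext p; simp [costCell]
  rw [this]
  refine MeasurableSet.iInter fun j => measurableSet_le ?_ ?_
  · exact ((hC' i).comp measurable_snd).sub ((measurable_pi_apply i).comp measurable_fst)
  · exact ((hC' j).comp measurable_snd).sub ((measurable_pi_apply j).comp measurable_fst)

theorem measurableSet_costCell (hC : Measurable C) (w : Fin n → ℝ) (i : Fin n) :
    MeasurableSet (costCell C w i) :=
  measurable_prodMk_left (x := w) (measurableSet_costCell_joint C hC i)

variable {C a μ}

theorem ae_no_tie (hT : ∀ i j, i ≠ j → ∀ r : ℝ, μ {z | C z i - C z j = r} = 0) (w : Fin n → ℝ) :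
    ∀ᵐ z ∂μ, ∀ i j, i ≠ j → C z i - w i ≠ C z j - w j := by
  rw [ae_all_iff]; intro i
  rw [ae_all_iff]; intro j
  by_cases hij : i = j
  · simp [hij]
  · have : ∀ᵐ z ∂μ, C z i - C z j ≠ w i - w j := by
      rw [ae_iff]; simpa using hT i j hij (w i - w j)
    filter_upwards [this] with z hz _ h
    exact hz (by linarith)

/-- Almost every point lies in exactly one cell. -/
theorem ae_exists_unique_costCell [NeZero n]
    (hT : ∀ i j, i ≠ j → ∀ r : ℝ, μ {z | C z i - C z j = r} = 0) (w : Fin n → ℝ) :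
    ∀ᵐ z ∂μ, ∃ i, z ∈ costCell C w i ∧
      ∀ j, (costCell C w j).indicator (fun _ => (1 : ℝ)) z = if j = i then 1 else 0 := by
  filter_upwards [ae_no_tie hT w] with z hz
  obtain ⟨i, hi⟩ := exists_mem_costCell C w z
  refine ⟨i, hi, fun j => ?_⟩
  split_ifs with hj
  · subst hj; simp [hi]
  · rw [Set.indicator_of_notMem]
    intro hj'
    exact hz j i hj (le_antisymm (hj' i) (hi j))

theorem measurable_iInf_cost (hC : Measurable C) (w : Fin n → ℝ) :
    Measurable fun z => ⨅ i, (C z i - w i) :=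
  Measurable.iInf fun i => ((measurable_pi_apply i).comp hC).sub_const _

theorem integrable_iInf_cost [IsFiniteMeasure μ] [NeZero n] (hC : Measurable C)
    (hI : ∀ i, Integrable (fun z => C z i) μ) (w : Fin n → ℝ) :
    Integrable (fun z => ⨅ i, (C z i - w i)) μ := by
  refine Integrable.mono' (g := fun z => ∑ i, |C z i - w i|)
    (integrable_finsetSum _ fun i _ => ((hI i).sub (integrable_const _)).abs)
    (measurable_iInf_cost hC w).aestronglyMeasurable (Eventually.of_forall fun z => ?_)
  obtain ⟨i, hi⟩ := exists_mem_costCell C w z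
  rw [iInf_eq_of_mem_costCell hi, Real.norm_eq_abs]
  exact Finset.single_le_sum (f := fun i => |C z i - w i|) (fun _ _ => abs_nonneg _)
    (Finset.mem_univ i)

/-- Almost every `z` has a single winning index for `w`. Using that index as a competitor in the
minimum for `v` gives a pointwise bound, and integrating it turns the indicators into cell masses.
-/
theorem costDual_le [IsProbabilityMeasure μ] [NeZero n] (hC : Measurable C)
    (hI : ∀ i, Integrable (fun z => C z i) μ)
    (hT : ∀ i j, i ≠ j → ∀ r : ℝ, μ {z | C z i - C z j = r} = 0) (w v : Fin n → ℝ) :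
    costDual C a μ v ≤ costDual C a μ w + ∑ i, costGrad C a μ w i * (v i - w i) := by
  have hind : ∀ i, Integrable (fun z => (costCell C w i).indicator (fun _ => (1 : ℝ)) z) μ :=
    fun i => (integrable_const _).indicator (measurableSet_costCell C hC w i)
  have hs : Integrable (fun z => ∑ i, (costCell C w i).indicator (fun _ => (1 : ℝ)) z *
      (w i - v i)) μ := integrable_finsetSum _ fun i _ => (hind i).mul_const _
  have h : ∫ z, ⨅ i, (C z i - v i) ∂μ ≤ ∫ z, ((⨅ i, (C z i - w i)) +
      ∑ i, (costCell C w i).indicator (fun _ => (1 : ℝ)) z * (w i - v i)) ∂μ := by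
    refine integral_mono_ae (integrable_iInf_cost hC hI v)
      ((integrable_iInf_cost hC hI w).add hs) ?_
    filter_upwards [ae_exists_unique_costCell hT w] with z ⟨i, hi, hz⟩
    rw [iInf_eq_of_mem_costCell hi]
    simp only [hz, ite_mul, one_mul, zero_mul, Finset.sum_ite_eq', Finset.mem_univ, if_true]
    have := ciInf_le (f := fun j => C z j - v j) (Set.finite_range _).bddBelow i
    linarith
  rw [integral_add (integrable_iInf_cost hC hI w) hs,
    integral_finsetSum _ fun i _ => (hind i).mul_const _] at h
  simp only [integral_mul_const, integral_indicator_const _ (measurableSet_costCell C hC w _),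
    smul_eq_mul, mul_one] at h
  have h2 : ∑ i, costGrad C a μ w i * (v i - w i) = ∑ i, a i * v i - ∑ i, a i * w i +
      ∑ i, μ.real (costCell C w i) * (w i - v i) := by
    rw [← Finset.sum_sub_distrib, ← Finset.sum_add_distrib]
    refine Finset.sum_congr rfl fun i _ => ?_
    rw [costGrad]; ring
  rw [costDual, costDual, h2]
  linarith

/-- The cells partition the space up to a null set, so their masses sum to one. This lets all
weights be shifted by a common constant without decreasing the dual function. -/
theorem sum_costGrad [IsProbabilityMeasure μ] [NeZero n] (hC : Measurable C)
    (hT : ∀ i j, i ≠ j → ∀ r : ℝ, μ {z | C z i - C z j = r} = 0) (ha : ∑ i, a i = 1)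
    (w : Fin n → ℝ) : ∑ i, costGrad C a μ w i = 0 := by
  have hind : ∀ i, Integrable (fun z => (costCell C w i).indicator (fun _ => (1 : ℝ)) z) μ :=
    fun i => (integrable_const _).indicator (measurableSet_costCell C hC w i)
  have h : ∫ z, ∑ i, (costCell C w i).indicator (fun _ => (1 : ℝ)) z ∂μ = ∫ _, (1 : ℝ) ∂μ := by
    refine integral_congr_ae ?_
    filter_upwards [ae_exists_unique_costCell hT w] with z ⟨i, hi, hz⟩
    simp [hz]
  rw [integral_finsetSum _ fun i _ => hind i] at h
  simp only [integral_indicator_const _ (measurableSet_costCell C hC w _), smul_eq_mul,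
    mul_one, integral_const, probReal_univ] at h
  simp only [costGrad, Finset.sum_sub_distrib, ha, h, sub_self]

theorem abs_costGrad_le [IsProbabilityMeasure μ] (h0 : ∀ i, 0 ≤ a i) (h1 : ∀ i, a i ≤ 1)
    (w : Fin n → ℝ) (i : Fin n) : |costGrad C a μ w i| ≤ 1 := by
  have h2 : 0 ≤ μ.real (costCell C w i) := measureReal_nonneg
  have h3 : μ.real (costCell C w i) ≤ 1 := measureReal_le_one
  rw [costGrad, abs_le]
  constructor <;> linarith [h0 i, h1 i]

/-- The supergradient has coordinates bounded by one, so the dual function is Lipschitz with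
constant `n` for the sup distance. -/
theorem continuous_costDual [IsProbabilityMeasure μ] [NeZero n] (hC : Measurable C)
    (hI : ∀ i, Integrable (fun z => C z i) μ)
    (hT : ∀ i j, i ≠ j → ∀ r : ℝ, μ {z | C z i - C z j = r} = 0)
    (h0 : ∀ i, 0 ≤ a i) (h1 : ∀ i, a i ≤ 1) : Continuous (costDual C a μ) := by
  have key : ∀ w v, costDual C a μ v ≤ costDual C a μ w + n * dist v w := by
    intro w v
    refine (costDual_le hC hI hT w v).trans (add_le_add_right ?_ _)
    calc ∑ i, costGrad C a μ w i * (v i - w i) ≤ ∑ _i : Fin n, dist v w := by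
          refine Finset.sum_le_sum fun i _ => (le_abs_self _).trans ?_
          rw [abs_mul]
          have h2 : |v i - w i| ≤ dist v w := by
            rw [← Real.dist_eq]; exact dist_le_pi_dist v w i
          calc _ ≤ 1 * |v i - w i| := by gcongr; exact abs_costGrad_le h0 h1 w i
            _ ≤ _ := by rwa [one_mul]
      _ = n * dist v w := by simp
  refine (LipschitzWith.of_le_add_mul (n : NNReal) fun x y => ?_).continuous
  simpa using key y x

/-- The dual function attains its maximum. -/
theorem exists_costDual_max [IsProbabilityMeasure μ] [NeZero n] (hC : Measurable C)
    (hI : ∀ i, Integrable (fun z => C z i) μ)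
    (hT : ∀ i j, i ≠ j → ∀ r : ℝ, μ {z | C z i - C z j = r} = 0)
    (h0 : ∀ i, 0 < a i) (ha : ∑ i, a i = 1) : ∃ w, ∀ v, costDual C a μ v ≤ costDual C a μ w := by
  have h1 : ∀ i, a i ≤ 1 := fun i => ha ▸ Finset.single_le_sum (f := a) (fun j _ => (h0 j).le)
    (Finset.mem_univ i)
  have hshift : ∀ w (t : ℝ), costDual C a μ w ≤ costDual C a μ fun i => w i - t := by
    intro w t
    have := costDual_le (a := a) hC hI hT (fun i => w i - t) w
    simpa [← Finset.sum_mul, sum_costGrad hC hT ha] using this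
  set B := ∑ i, |∫ z, C z i ∂μ|
  have hbound : ∀ w i, costDual C a μ w ≤ B - w i + ∑ j, a j * w j := by
    intro w i
    have h2 : ∫ z, ⨅ j, (C z j - w j) ∂μ ≤ ∫ z, (C z i - w i) ∂μ :=
      integral_mono (integrable_iInf_cost hC hI w) ((hI i).sub (integrable_const _))
        fun z => ciInf_le (Set.finite_range _).bddBelow i
    rw [integral_sub (hI i) (integrable_const _)] at h2
    have h3 : ∫ z, C z i ∂μ ≤ B := (le_abs_self _).trans
      (Finset.single_le_sum (f := fun i => |∫ z, C z i ∂μ|) (fun _ _ => abs_nonneg _)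
        (Finset.mem_univ i))
    simp only [integral_const, probReal_univ, one_smul] at h2
    rw [costDual]; linarith
  -- Shift so that the largest weight is zero. If weight `j` is then below `-R`, with `R ≥ D / a j`,
  -- `hbound` gives a value at most `B - D`, no better than at the origin. Only the cube `[-R, 0]^n`
  -- remains, where compactness applies.
  set D := |B - costDual C a μ 0|
  set R := ∑ i, D / a i
  have hRnn : 0 ≤ R := Finset.sum_nonneg fun i _ => div_nonneg (abs_nonneg _) (h0 i).le
  obtain ⟨w, -, hw⟩ := (isCompact_univ_pi fun _ : Fin n =>
    isCompact_Icc (a := -R) (b := 0)).exists_isMaxOn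
    ⟨0, Set.mem_univ_pi.mpr fun j => by simp [hRnn]⟩
    (continuous_costDual (a := a) hC hI hT (fun i => (h0 i).le) h1).continuousOn
  refine ⟨w, fun v => ?_⟩
  obtain ⟨i, hi⟩ := Finite.exists_max v
  refine (hshift v (v i)).trans ?_
  by_cases hmem : ∀ j, -R ≤ v j - v i
  · exact hw (Set.mem_univ_pi.mpr fun j => ⟨hmem j, by linarith [hi j]⟩)
  · push Not at hmem
    obtain ⟨j, hj⟩ := hmem
    have h00 : costDual C a μ 0 ≤ costDual C a μ w :=
      hw (Set.mem_univ_pi.mpr fun j => by simp [hRnn])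
    refine le_trans ?_ h00
    refine (hbound _ i).trans ?_
    have h4 : ∑ l, a l * (v l - v i) ≤ a j * (v j - v i) := by
      rw [← Finset.add_sum_erase _ _ (Finset.mem_univ j)]
      have : ∑ l ∈ Finset.univ.erase j, a l * (v l - v i) ≤ 0 :=
        Finset.sum_nonpos fun l _ => mul_nonpos_of_nonneg_of_nonpos (h0 l).le (by linarith [hi l])
      linarith
    have h5 : D / a j ≤ R := Finset.single_le_sum (f := fun i => D / a i)
      (fun i _ => div_nonneg (abs_nonneg _) (h0 i).le) (Finset.mem_univ j)
    have h6 : D ≤ a j * R := by rwa [div_le_iff₀' (h0 j)] at h5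
    have h7 : a j * (v j - v i) ≤ a j * -R := mul_le_mul_of_nonneg_left hj.le (h0 j).le
    have h8 : B - costDual C a μ 0 ≤ D := le_abs_self _
    simp only [sub_self]
    linarith

/-- Away from ties at `w`, the comparisons between distinct indices are strict and survive small
changes of the weights. The cell indicator is thus locally constant in the weights at almost every
point, and dominated convergence applies. -/
theorem continuous_costGrad [IsProbabilityMeasure μ] (hC : Measurable C)
    (hT : ∀ i j, i ≠ j → ∀ r : ℝ, μ {z | C z i - C z j = r} = 0) (i : Fin n) :
    Continuous fun w => costGrad C a μ w i := by
  refine continuous_const.sub (continuous_iff_continuousAt.mpr fun w => ?_)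
  have hreal : ∀ v, μ.real (costCell C v i) =
      ∫ z, (costCell C v i).indicator (fun _ => (1 : ℝ)) z ∂μ := fun v => by
    simp [integral_indicator_const _ (measurableSet_costCell C hC v i)]
  simp only [ContinuousAt, hreal]
  refine tendsto_integral_filter_of_dominated_convergence (fun _ => (1 : ℝ))
    (Eventually.of_forall fun v =>
      (measurable_const.indicator (measurableSet_costCell C hC v i)).aestronglyMeasurable)
    (Eventually.of_forall fun v => Eventually.of_forall fun z => ?_) (integrable_const _) ?_
  · by_cases hz : z ∈ costCell C v i <;> simp [hz]
  · filter_upwards [ae_no_tie hT w] with z hz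
    have hev : ∀ᶠ v in 𝓝 w, (z ∈ costCell C v i ↔ z ∈ costCell C w i) := by
      have : ∀ᶠ v : Fin n → ℝ in 𝓝 w, ∀ j,
          (C z i - v i ≤ C z j - v j ↔ C z i - w i ≤ C z j - w j) := by
        rw [eventually_all]
        intro j
        by_cases hij : i = j
        · subst hij; simp
        have hl : Tendsto (fun v : Fin n → ℝ => C z i - v i) (𝓝 w) (𝓝 (C z i - w i)) :=
          (continuous_const.sub (continuous_apply i)).tendsto w
        have hr : Tendsto (fun v : Fin n → ℝ => C z j - v j) (𝓝 w) (𝓝 (C z j - w j)) :=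
          (continuous_const.sub (continuous_apply j)).tendsto w
        rcases lt_or_gt_of_ne (hz i j hij) with h | h
        · filter_upwards [hl.eventually_lt hr h] with v hv
          exact iff_of_true hv.le h.le
        · filter_upwards [hr.eventually_lt hl h] with v hv
          exact iff_of_false hv.not_ge h.not_ge
      filter_upwards [this] with v hv
      exact forall_congr' hv
    refine tendsto_const_nhds.congr' ?_
    filter_upwards [hev] with v hv
    by_cases h : z ∈ costCell C w i
    · simp [h, hv.mpr h]
    · rw [Set.indicator_of_notMem h, Set.indicator_of_notMem fun h' => h (hv.mp h')]

/-- The supergradient vanishes at a maximizer of the dual function. -/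
theorem costGrad_eq_zero_of_max [IsProbabilityMeasure μ] [NeZero n] (hC : Measurable C)
    (hI : ∀ i, Integrable (fun z => C z i) μ)
    (hT : ∀ i j, i ≠ j → ∀ r : ℝ, μ {z | C z i - C z j = r} = 0) {w : Fin n → ℝ}
    (hw : ∀ v, costDual C a μ v ≤ costDual C a μ w) (i : Fin n) : costGrad C a μ w i = 0 := by
  set s := costGrad C a μ w with hs
  -- Test along the ray `w + t * s`. The supergradient inequality based there and evaluated at `w`,
  -- with maximality of `w`, makes the inner product with `s` nonpositive; letting `t` decrease to
  -- zero leaves the squared norm of `s`.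
  have hcont : Continuous fun t : ℝ => ∑ j, costGrad C a μ (fun l => w l + t * s l) j * s j := by
    refine continuous_finsetSum _ fun j _ => Continuous.mul ?_ continuous_const
    exact (continuous_costGrad hC hT j).comp (continuous_pi fun l => by fun_prop)
  have hle : ∀ t : ℝ, 0 < t → ∑ j, costGrad C a μ (fun l => w l + t * s l) j * s j ≤ 0 := by
    intro t ht
    have h1 := costDual_le (a := a) hC hI hT (fun l => w l + t * s l) w
    have h2 := hw fun l => w l + t * s l
    have h3 : ∑ j, costGrad C a μ (fun l => w l + t * s l) j * (w j - (w j + t * s j)) =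
        -(t * ∑ j, costGrad C a μ (fun l => w l + t * s l) j * s j) := by
      rw [Finset.mul_sum, ← Finset.sum_neg_distrib]
      exact Finset.sum_congr rfl fun j _ => by ring
    rw [h3] at h1
    by_contra! h4
    linarith [mul_pos ht h4]
  have hlim : Tendsto (fun t : ℝ => ∑ j, costGrad C a μ (fun l => w l + t * s l) j * s j)
      (𝓝[>] 0) (𝓝 (∑ j, s j * s j)) := by
    have := (hcont.tendsto 0).mono_left (nhdsWithin_le_nhds (s := Set.Ioi 0))
    simpa [hs] using this
  have h0 : ∑ j, s j * s j ≤ 0 :=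
    le_of_tendsto hlim (by filter_upwards [self_mem_nhdsWithin] with t ht using hle t ht)
  have h1 := (Finset.sum_eq_zero_iff_of_nonneg fun j _ => mul_self_nonneg (s j)).mp
    (le_antisymm h0 (Finset.sum_nonneg fun j _ => mul_self_nonneg (s j))) i (Finset.mem_univ i)
  exact mul_self_eq_zero.mp h1

end Dual

/-! ### Freezing the past against a fresh sample. -/

section Independence


/-- If `X` is `m`-measurable and `Z` is independent of `m`, then on `m`-measurable sets `Z` may be
integrated out with `X` frozen. -/
theorem setIntegral_comp_of_indep {Ω E β : Type*} {m mΩ : MeasurableSpace Ω} [MeasurableSpace E]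
    [MeasurableSpace β] {P : Measure Ω} [IsProbabilityMeasure P] (hm : m ≤ mΩ) {X : Ω → β}
    (hX : Measurable[m] X) {Z : Ω → E} (hZ : Measurable Z)
    (hind : Indep m (MeasurableSpace.comap Z inferInstance) P) {ψ : β × E → ℝ}
    (hψ : Measurable ψ) (hint : Integrable (fun ω => ψ (X ω, Z ω)) P) {A : Set Ω}
    (hA : MeasurableSet[m] A) :
    ∫ ω in A, ψ (X ω, Z ω) ∂P = ∫ ω in A, ∫ z, ψ (X ω, z) ∂(P.map Z) ∂P := by
  -- Bundling the indicator of `A` with `X` gives one variable independent of `Z`, so Fubini for the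
  -- product law handles the restriction to `A`.
  set Y : Ω → ℝ × β := fun ω => (A.indicator (fun _ => (1 : ℝ)) ω, X ω) with hY
  set φ : (ℝ × β) × E → ℝ := fun p => p.1.1 * ψ (p.1.2, p.2) with hφ
  have hφm : Measurable φ := by fun_prop
  have hYm' : Measurable[m] Y := Measurable.prodMk (measurable_const.indicator hA) hX
  have hYm : Measurable Y := hYm'.mono hm le_rfl
  have hYZ : IndepFun Y Z P := indep_of_indep_of_le_left hind hYm'.comap_le
  have hmap := hYZ.map_prod_eq_prod_map_map hYm.aemeasurable hZ.aemeasurable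
  have hφA : ∀ ω z, φ (Y ω, z) = A.indicator (fun ω => ψ (X ω, z)) ω := fun ω z => by
    by_cases h : ω ∈ A <;> simp [hφ, hY, h]
  have hφA' : ∀ ω, φ (Y ω, Z ω) = A.indicator (fun ω => ψ (X ω, Z ω)) ω := fun ω => by
    by_cases h : ω ∈ A <;> simp [hφ, hY, h]
  have hprod : Integrable φ ((P.map Y).prod (P.map Z)) := by
    rw [← hmap, integrable_map_measure hφm.aestronglyMeasurable (hYm.prodMk hZ).aemeasurable]
    refine (hint.indicator (hm _ hA)).congr (Eventually.of_forall fun ω => (hφA' ω).symm)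
  have := Measure.isProbabilityMeasure_map (μ := P) hYm.aemeasurable
  have := Measure.isProbabilityMeasure_map (μ := P) hZ.aemeasurable
  calc ∫ ω in A, ψ (X ω, Z ω) ∂P = ∫ ω, φ (Y ω, Z ω) ∂P := by
        simp only [hφA', integral_indicator (hm _ hA)]
    _ = ∫ p, φ p ∂((P.map Y).prod (P.map Z)) := by
        rw [← hmap, integral_map (hYm.prodMk hZ).aemeasurable hφm.aestronglyMeasurable]
    _ = ∫ y, ∫ z, φ (y, z) ∂(P.map Z) ∂(P.map Y) := integral_prod _ hprod
    _ = ∫ ω, ∫ z, φ (Y ω, z) ∂(P.map Z) ∂P := by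
        rw [integral_map hYm.aemeasurable]
        exact hφm.stronglyMeasurable.integral_prod_right.aestronglyMeasurable
    _ = ∫ ω in A, ∫ z, ψ (X ω, z) ∂(P.map Z) ∂P := by
        rw [← integral_indicator (hm _ hA)]
        refine integral_congr_ae (Eventually.of_forall fun ω => ?_)
        by_cases h : ω ∈ A <;> simp [hφ, hY, h]

variable {Ω E : Type*} {mΩ : MeasurableSpace Ω} [MeasurableSpace E] {P : Measure Ω}

/-- The filtration of the strict past of a sequence of random variables. -/
def pastFiltration (Z : ℕ → Ω → E) (hZ : ∀ k, Measurable (Z k)) : Filtration ℕ mΩ where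
  seq k := ⨆ j ∈ Set.Iio k, MeasurableSpace.comap (Z j) inferInstance
  mono' _ _ h := biSup_mono fun _ hj => lt_of_lt_of_le hj h
  le' _ := iSup₂_le fun j _ => (hZ j).comap_le

theorem measurable_pastFiltration (Z : ℕ → Ω → E) (hZ : ∀ k, Measurable (Z k)) {j k : ℕ}
    (h : j < k) : Measurable[pastFiltration Z hZ k] (Z j) :=
  measurable_iff_comap_le.mpr
    (le_biSup (fun j => MeasurableSpace.comap (Z j) inferInstance) (Set.mem_Iio.mpr h))

theorem indep_pastFiltration {Z : ℕ → Ω → E} (hZ : ∀ k, Measurable (Z k)) (hind : iIndepFun Z P)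
    (k : ℕ) : Indep (pastFiltration Z hZ k) (MeasurableSpace.comap (Z k) inferInstance) P := by
  have := indep_iSup_of_disjoint (fun j => (hZ j).comap_le) hind
    (S := Set.Iio k) (T := {k}) (by simp)
  simpa [pastFiltration] using this

end Independence

/-! ### The iteration and its Lyapunov supermartingale. -/

section Weights

variable {Ω E : Type*} {mΩ : MeasurableSpace Ω} [MeasurableSpace E] {n : ℕ}

/-- The stochastic supergradient iteration for the cost vector `C` along the samples `z`. -/
def costWeights (C : E → Fin n → ℝ) (a : Fin n → ℝ) (γ : ℕ → ℝ) (z : ℕ → E) : ℕ → Fin n → ℝ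
  | 0 => 0
  | k + 1 => fun i => costWeights C a γ z k i +
      γ k * (a i - (costCell C (costWeights C a γ z k) i).indicator (fun _ => (1 : ℝ)) (z k))

variable {C : E → Fin n → ℝ} {a : Fin n → ℝ} {γ : ℕ → ℝ}

omit [MeasurableSpace E] in
theorem abs_sub_indicator_le_one (h0 : ∀ i, 0 ≤ a i) (h1 : ∀ i, a i ≤ 1) (i : Fin n) (s : Set E)
    (z : E) : |a i - s.indicator (fun _ => (1 : ℝ)) z| ≤ 1 := by
  rw [abs_le]
  by_cases h : z ∈ s <;> simp only [h, Set.indicator_of_mem, Set.indicator_of_notMem,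
    not_false_eq_true] <;> constructor <;> linarith [h0 i, h1 i]

omit [MeasurableSpace E] in
theorem abs_costWeights_le (h0 : ∀ i, 0 ≤ a i) (h1 : ∀ i, a i ≤ 1) (hγ : ∀ k, 0 ≤ γ k)
    (z : ℕ → E) (k : ℕ) (i : Fin n) :
    |costWeights C a γ z k i| ≤ ∑ j ∈ Finset.range k, γ j := by
  induction k with
  | zero => simp [costWeights]
  | succ k ih =>
    rw [costWeights, Finset.sum_range_succ]
    refine (abs_add_le _ _).trans (add_le_add ih ?_)
    rw [abs_mul, abs_of_nonneg (hγ k)]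
    exact mul_le_of_le_one_right (hγ k) (abs_sub_indicator_le_one h0 h1 i _ _)

theorem measurable_indicator_costCell (hC : Measurable C) (i : Fin n) :
    Measurable fun p : (Fin n → ℝ) × E =>
      (costCell C p.1 i).indicator (fun _ => (1 : ℝ)) p.2 :=
  (measurable_const (a := (1 : ℝ))).indicator (measurableSet_costCell_joint C hC i)

theorem measurable_costWeights (hC : Measurable C) (Z : ℕ → Ω → E) (hZ : ∀ k, Measurable (Z k))
    (k : ℕ) : Measurable[pastFiltration Z hZ k] fun ω => costWeights C a γ (fun l => Z l ω) k := by
  induction k with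
  | zero => exact measurable_const
  | succ k ih =>
    have h1 := ih.mono ((pastFiltration Z hZ).mono k.le_succ) le_rfl
    have h2 := measurable_pastFiltration Z hZ k.lt_succ_self
    have h3 : Measurable fun p : (Fin n → ℝ) × E => fun i => p.1 i +
        γ k * (a i - (costCell C p.1 i).indicator (fun _ => (1 : ℝ)) p.2) := by
      have := fun i => measurable_indicator_costCell hC i
      fun_prop
    exact h3.comp (h1.prodMk h2)

variable {P : Measure Ω} [IsProbabilityMeasure P]

/-- For fixed `k` the iterate stays in a deterministic cube, on which a continuous function is
bounded. -/
theorem integrable_comp_costWeights (hC : Measurable C) {Z : ℕ → Ω → E}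
    (hZ : ∀ k, Measurable (Z k)) (h0 : ∀ i, 0 ≤ a i) (h1 : ∀ i, a i ≤ 1) (hγ : ∀ k, 0 ≤ γ k)
    {φ : (Fin n → ℝ) → ℝ} (hφ : Continuous φ) (k : ℕ) :
    Integrable (fun ω => φ (costWeights C a γ (fun l => Z l ω) k)) P := by
  set R := ∑ j ∈ Finset.range k, γ j
  obtain ⟨B, hB⟩ := (isCompact_univ_pi fun _ : Fin n => isCompact_Icc (a := -R)
    (b := R)).exists_bound_of_continuousOn hφ.continuousOn
  refine Integrable.of_bound (C := B) ?_ (Eventually.of_forall fun ω => ?_)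
  · exact (hφ.measurable.comp ((measurable_costWeights hC Z hZ k).mono
      ((pastFiltration Z hZ).le k) le_rfl)).aestronglyMeasurable
  · exact hB _ (Set.mem_univ_pi.mpr fun i => abs_le.mp (abs_costWeights_le h0 h1 hγ _ k i))

variable (C a γ) in
/-- The Lyapunov process of the iteration relative to the reference point `d`. -/
def lyapunov (μ : Measure E) (d : Fin n → ℝ) (z : ℕ → E) (k : ℕ) : ℝ :=
  ∑ i, (costWeights C a γ z k i - d i) ^ 2 +
    ∑ j ∈ Finset.range k, (2 * γ j * ∑ i, costGrad C a μ (costWeights C a γ z j) i *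
      (d i - costWeights C a γ z j i) - n * γ j ^ 2)

/-- Expand the square: the `n` second-order terms are each at most `γ k ^ 2` and are absorbed by the
compensator. What remains is the sampled drift minus its mean. -/
theorem lyapunov_succ_le (h0 : ∀ i, 0 ≤ a i) (h1 : ∀ i, a i ≤ 1) (μ : Measure E)
    (d : Fin n → ℝ) (z : ℕ → E) (k : ℕ) :
    lyapunov C a γ μ d z (k + 1) ≤ lyapunov C a γ μ d z k + 2 * γ k *
      (∑ i, (a i - (costCell C (costWeights C a γ z k) i).indicator (fun _ => (1 : ℝ)) (z k)) *
        (costWeights C a γ z k i - d i) +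
       ∑ i, costGrad C a μ (costWeights C a γ z k) i * (d i - costWeights C a γ z k i)) := by
  have key : ∑ i, (costWeights C a γ z (k + 1) i - d i) ^ 2 ≤
      ∑ i, (costWeights C a γ z k i - d i) ^ 2 + 2 * γ k * ∑ i, (a i - (costCell C
        (costWeights C a γ z k) i).indicator (fun _ => (1 : ℝ)) (z k)) *
        (costWeights C a γ z k i - d i) + n * γ k ^ 2 := by
    have hn : (n : ℝ) * γ k ^ 2 = ∑ _i : Fin n, γ k ^ 2 := by simp
    rw [hn, Finset.mul_sum, ← Finset.sum_add_distrib, ← Finset.sum_add_distrib]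
    refine Finset.sum_le_sum fun i _ => ?_
    rw [costWeights]
    set ξ := a i - (costCell C (costWeights C a γ z k) i).indicator (fun _ => (1 : ℝ)) (z k)
    have hξ : ξ ^ 2 ≤ 1 := (sq_le_one_iff_abs_le_one _).mpr (abs_sub_indicator_le_one h0 h1 i _ _)
    have := mul_le_mul_of_nonneg_left hξ (sq_nonneg (γ k))
    linarith
  rw [lyapunov, lyapunov, Finset.sum_range_succ]
  linarith

theorem lyapunov_integrable_adapted {μ : Measure E} [IsProbabilityMeasure μ] (hC : Measurable C)
    (hT : ∀ i j, i ≠ j → ∀ r : ℝ, μ {z | C z i - C z j = r} = 0) {Z : ℕ → Ω → E}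
    (hZ : ∀ k, Measurable (Z k)) (h0 : ∀ i, 0 ≤ a i) (h1 : ∀ i, a i ≤ 1) (hγ : ∀ k, 0 ≤ γ k)
    (d : Fin n → ℝ) (k : ℕ) :
    Integrable (fun ω => lyapunov C a γ μ d (fun l => Z l ω) k) P ∧
      Measurable[pastFiltration Z hZ k] fun ω => lyapunov C a γ μ d (fun l => Z l ω) k := by
  have hφ1 : Continuous fun w : Fin n → ℝ => ∑ i, (w i - d i) ^ 2 := by fun_prop
  have hφ2 : ∀ j, Continuous fun w : Fin n → ℝ =>
      2 * γ j * ∑ i, costGrad C a μ w i * (d i - w i) - n * γ j ^ 2 := fun j => by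
    have := fun i => continuous_costGrad (a := a) hC hT i
    fun_prop
  constructor
  · exact (integrable_comp_costWeights hC hZ h0 h1 hγ hφ1 k).add (integrable_finsetSum _
      fun j _ => integrable_comp_costWeights hC hZ h0 h1 hγ (hφ2 j) j)
  · exact (hφ1.measurable.comp (measurable_costWeights hC Z hZ k)).add (Finset.measurable_fun_sum _
      fun j hj => (hφ2 j).measurable.comp ((measurable_costWeights hC Z hZ j).mono
        ((pastFiltration Z hZ).mono (Finset.mem_range.mp hj).le) le_rfl))

theorem supermartingale_lyapunov {μ : Measure E} [IsProbabilityMeasure μ] (hC : Measurable C)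
    (hT : ∀ i j, i ≠ j → ∀ r : ℝ, μ {z | C z i - C z j = r} = 0) {Z : ℕ → Ω → E}
    (hZ : ∀ k, Measurable (Z k)) (hlaw : ∀ k, P.map (Z k) = μ) (hind : iIndepFun Z P)
    (h0 : ∀ i, 0 ≤ a i) (h1 : ∀ i, a i ≤ 1) (hγ : ∀ k, 0 ≤ γ k) (d : Fin n → ℝ) :
    Supermartingale (fun k ω => lyapunov C a γ μ d (fun l => Z l ω) k) (pastFiltration Z hZ) P := by
  have hIA := fun k => lyapunov_integrable_adapted (P := P) hC hT hZ h0 h1 hγ d k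
  refine supermartingale_of_setIntegral_succ_le (fun k => (hIA k).2.stronglyMeasurable)
    (fun k => (hIA k).1) fun k A hA => ?_
  set ψ : (Fin n → ℝ) × E → ℝ := fun p =>
    ∑ i, (a i - (costCell C p.1 i).indicator (fun _ => (1 : ℝ)) p.2) * (p.1 i - d i) with hψ
  have hψm : Measurable ψ := by
    have := fun i => measurable_indicator_costCell hC i
    fun_prop
  set W : Ω → Fin n → ℝ := fun ω => costWeights C a γ (fun l => Z l ω) k
  have hWm := measurable_costWeights (a := a) (γ := γ) hC Z hZ k
  have hψint : Integrable (fun ω => ψ (W ω, Z k ω)) P := by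
    have hb : Continuous fun w : Fin n → ℝ => ∑ i, |w i - d i| := by fun_prop
    refine (integrable_comp_costWeights hC hZ h0 h1 hγ hb k).mono' (hψm.comp
      ((hWm.mono ((pastFiltration Z hZ).le k) le_rfl).prodMk (hZ k))).aestronglyMeasurable
      (Eventually.of_forall fun ω => (Finset.abs_sum_le_sum_abs _ _).trans
        (Finset.sum_le_sum fun i _ => ?_))
    rw [abs_mul]
    exact mul_le_of_le_one_left (abs_nonneg _) (abs_sub_indicator_le_one h0 h1 i _ _)
  have hψμ : ∀ w, ∫ z, ψ (w, z) ∂μ = -∑ i, costGrad C a μ w i * (d i - w i) := by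
    intro w
    have hii : ∀ i, Integrable (fun z => (costCell C w i).indicator (fun _ => (1 : ℝ)) z) μ :=
      fun i => (integrable_const _).indicator (measurableSet_costCell C hC w i)
    simp only [hψ]
    have hij : ∀ i, Integrable (fun z => (a i - (costCell C w i).indicator (fun _ => (1 : ℝ)) z) *
        (w i - d i)) μ := fun i => ((integrable_const _).sub (hii i)).mul_const _
    rw [integral_finsetSum _ fun i _ => hij i, ← Finset.sum_neg_distrib]
    refine Finset.sum_congr rfl fun i _ => ?_
    rw [integral_mul_const, integral_sub (integrable_const _) (hii i),
      integral_indicator_const _ (measurableSet_costCell C hC w i)]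
    simp only [integral_const, probReal_univ, smul_eq_mul, mul_one, costGrad]
    ring
  have hD : Continuous fun w : Fin n → ℝ => ∑ i, costGrad C a μ w i * (d i - w i) := by
    have := fun i => continuous_costGrad (a := a) hC hT i
    fun_prop
  have hDint := integrable_comp_costWeights (P := P) hC hZ h0 h1 hγ hD k
  have hinc : Integrable (fun ω => 2 * γ k * (ψ (W ω, Z k ω) +
      ∑ i, costGrad C a μ (W ω) i * (d i - W ω i))) P := (hψint.add hDint).const_mul _
  -- The iterate depends only on earlier samples, so integrating out the fresh one replaces the
  -- indicators by cell masses and the increment has mean zero on `A`.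
  have hzero : ∫ ω in A, (ψ (W ω, Z k ω) +
      ∑ i, costGrad C a μ (W ω) i * (d i - W ω i)) ∂P = 0 := by
    rw [integral_add hψint.integrableOn hDint.integrableOn,
      setIntegral_comp_of_indep ((pastFiltration Z hZ).le k) hWm (hZ k)
        (indep_pastFiltration hZ hind k) hψm hψint hA, hlaw k]
    simp only [hψμ, integral_neg, neg_add_cancel]
  calc ∫ ω in A, lyapunov C a γ μ d (fun l => Z l ω) (k + 1) ∂P
      ≤ ∫ ω in A, (lyapunov C a γ μ d (fun l => Z l ω) k + 2 * γ k * (ψ (W ω, Z k ω) +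
          ∑ i, costGrad C a μ (W ω) i * (d i - W ω i))) ∂P :=
        integral_mono (hIA (k + 1)).1.integrableOn
          ((hIA k).1.add hinc).integrableOn
          fun ω => lyapunov_succ_le h0 h1 μ d _ k
    _ = ∫ ω in A, lyapunov C a γ μ d (fun l => Z l ω) k ∂P := by
        rw [integral_add (hIA k).1.integrableOn hinc.integrableOn,
          integral_const_mul, hzero, mul_zero, add_zero]

/-- Almost surely, the distance of the iterates to a point `d` with nonnegative drift converges,
and the weighted drifts are summable. -/
theorem ae_tendsto_dist_and_summable {μ : Measure E} [IsProbabilityMeasure μ] (hC : Measurable C)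
    (hT : ∀ i j, i ≠ j → ∀ r : ℝ, μ {z | C z i - C z j = r} = 0) {Z : ℕ → Ω → E}
    (hZ : ∀ k, Measurable (Z k)) (hlaw : ∀ k, P.map (Z k) = μ) (hind : iIndepFun Z P)
    (h0 : ∀ i, 0 ≤ a i) (h1 : ∀ i, a i ≤ 1) (hγ : ∀ k, 0 ≤ γ k)
    (hγ2 : Summable fun k => γ k ^ 2) {d : Fin n → ℝ}
    (hd : ∀ w, 0 ≤ ∑ i, costGrad C a μ w i * (d i - w i)) :
    ∀ᵐ ω ∂P, (∃ c, Tendsto (fun k => ∑ i, (costWeights C a γ (fun l => Z l ω) k i - d i) ^ 2)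
        atTop (𝓝 c)) ∧
      Summable fun k => γ k * ∑ i, costGrad C a μ (costWeights C a γ (fun l => Z l ω) k) i *
        (d i - costWeights C a γ (fun l => Z l ω) k i) := by
  have hS := supermartingale_lyapunov hC hT hZ hlaw hind h0 h1 hγ d
  set S : ℕ → Ω → ℝ := fun k ω => lyapunov C a γ μ d (fun l => Z l ω) k with hSdef
  set Γ : ℝ := ∑' k, γ k ^ 2
  have hdrift : ∀ ω k, ∑ i, (costWeights C a γ (fun l => Z l ω) k i - d i) ^ 2 +
      ∑ j ∈ Finset.range k, 2 * γ j * ∑ i, costGrad C a μ (costWeights C a γ (fun l => Z l ω) j) i *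
        (d i - costWeights C a γ (fun l => Z l ω) j i) =
      S k ω + n * ∑ j ∈ Finset.range k, γ j ^ 2 := by
    intro ω k
    simp only [hSdef, lyapunov, Finset.sum_sub_distrib, Finset.mul_sum]
    ring
  have hpos : ∀ ω k, 0 ≤ ∑ j ∈ Finset.range k, 2 * γ j *
      ∑ i, costGrad C a μ (costWeights C a γ (fun l => Z l ω) j) i *
        (d i - costWeights C a γ (fun l => Z l ω) j i) := fun ω k =>
    Finset.sum_nonneg fun j _ => mul_nonneg (mul_nonneg zero_le_two (hγ j)) (hd _)
  have hsq : ∀ ω k, 0 ≤ ∑ i, (costWeights C a γ (fun l => Z l ω) k i - d i) ^ 2 := fun ω k =>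
    Finset.sum_nonneg fun i _ => sq_nonneg _
  have hΓk : ∀ k, (n : ℝ) * ∑ j ∈ Finset.range k, γ j ^ 2 ≤ n * Γ := fun k =>
    mul_le_mul_of_nonneg_left (hγ2.sum_le_tsum _ fun _ _ => sq_nonneg _) n.cast_nonneg
  have hlow : ∀ ω k, 0 ≤ S k ω + n * Γ := fun ω k => by
    linarith [hdrift ω k, hpos ω k, hsq ω k, hΓk k]
  have hΓ0 : 0 ≤ n * Γ := mul_nonneg n.cast_nonneg (tsum_nonneg fun _ => sq_nonneg _)
  -- As `S k ≥ -n * Γ`, the modulus of `S k` is at most `S k + 2 * (n * Γ)`, and the mean of `S k`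
  -- does not exceed that of `S 0`. The L¹-bounded submartingale `-S` therefore converges.
  have hbdd : ∀ k, eLpNorm ((-S) k) 1 P ≤ ((∫ ω, S 0 ω ∂P) + 2 * (n * Γ)).toNNReal := by
    intro k
    have hnint : Integrable ((-S) k) P := (hS.integrable k).neg
    rw [eLpNorm_one_eq_lintegral_enorm, ← ofReal_integral_norm_eq_lintegral_enorm hnint]
    refine ENNReal.ofReal_le_ofReal ?_
    calc ∫ ω, ‖(-S) k ω‖ ∂P ≤ ∫ ω, (S k ω + 2 * (n * Γ)) ∂P := by
          refine integral_mono hnint.norm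
            ((hS.integrable k).add (integrable_const _)) fun ω => ?_
          simp only [Pi.neg_apply, norm_neg, Real.norm_eq_abs]
          exact abs_le.mpr ⟨by linarith [hlow ω k], by linarith [hΓ0]⟩
      _ = (∫ ω, S k ω ∂P) + 2 * (n * Γ) := by
          rw [integral_add (hS.integrable k) (integrable_const _)]; simp
      _ ≤ _ := by
          have := hS.setIntegral_le (Nat.zero_le k) MeasurableSet.univ
          simp only [setIntegral_univ] at this
          linarith
  filter_upwards [hS.neg.exists_ae_tendsto_of_bdd hbdd] with ω ⟨c, hc⟩
  have hc' : Tendsto (fun k => S k ω) atTop (𝓝 (-c)) := by simpa using hc.neg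
  obtain ⟨B, hB⟩ := hc'.bddAbove_range
  have hsum : Summable fun j => 2 * γ j *
      ∑ i, costGrad C a μ (costWeights C a γ (fun l => Z l ω) j) i *
        (d i - costWeights C a γ (fun l => Z l ω) j i) := by
    refine summable_of_sum_range_le (c := B + n * Γ)
      (fun j => mul_nonneg (mul_nonneg zero_le_two (hγ j)) (hd _)) fun k => ?_
    have : S k ω ≤ B := hB ⟨k, rfl⟩
    linarith [hdrift ω k, hsq ω k, hΓk k]
  refine ⟨⟨_, ((hc'.add (hγ2.tendsto_sum_tsum_nat.const_mul (n : ℝ))).sub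
    hsum.tendsto_sum_tsum_nat).congr fun k => ?_⟩, ?_⟩
  · linarith [hdrift ω k]
  · exact (hsum.mul_left (1 / 2)).congr fun j => by ring

end Weights

/-! ### Deterministic convergence from distances and drift. -/

section Convergence

variable {n : ℕ}

/-- A sequence whose distances to a dense set of zeros of `G` converge, and along which the drift
is summable against a divergent series, converges to a zero of `G`. -/
theorem exists_tendsto_zero_of_drift {G : (Fin n → ℝ) → Fin n → ℝ}
    (hG : ∀ i, Continuous fun w => G w i)
    {T : Set (Fin n → ℝ)} (hTne : T.Nonempty) (hT : {w | ∀ i, G w i = 0} ⊆ closure T)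
    (hpos : ∀ d ∈ T, ∀ w, 0 ≤ ∑ i, G w i * (d i - w i))
    (hzero : ∀ d ∈ T, ∀ w, ∑ i, G w i * (d i - w i) ≤ 0 → ∀ i, G w i = 0)
    {γ : ℕ → ℝ} (hγ : ∀ k, 0 ≤ γ k) (hγs : ¬ Summable γ) {w : ℕ → Fin n → ℝ}
    (hconv : ∀ d ∈ T, ∃ c, Tendsto (fun k => ∑ i, (w k i - d i) ^ 2) atTop (𝓝 c))
    (hsum : ∀ d ∈ T, Summable fun k => γ k * ∑ i, G (w k) i * (d i - w k i)) :
    ∃ v, (∀ i, G v i = 0) ∧ Tendsto w atTop (𝓝 v) := by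
  obtain ⟨d, hd⟩ := hTne
  -- A drift eventually at least `1 / (m + 1)` would bound `γ` by a multiple of a summable sequence.
  have hfreq : ∀ m : ℕ, ∃ᶠ k in atTop, ∑ i, G (w k) i * (d i - w k i) < 1 / ((m : ℝ) + 1) := by
    intro m hev
    have hm : (0 : ℝ) < m + 1 := by positivity
    refine hγs (summable_of_isBigO_nat (hsum d hd) (Asymptotics.IsBigO.of_bound (m + 1 : ℝ) ?_))
    filter_upwards [hev] with k hk
    rw [not_lt, div_le_iff₀ hm] at hk
    rw [Real.norm_of_nonneg (hγ k), Real.norm_of_nonneg (mul_nonneg (hγ k) (hpos d hd _))]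
    nlinarith [mul_le_mul_of_nonneg_left hk (hγ k)]
  obtain ⟨φ, hφ, hφd⟩ := extraction_forall_of_frequently hfreq
  obtain ⟨c, hc⟩ := hconv d hd
  obtain ⟨B, hB⟩ := hc.bddAbove_range
  have hmem : ∀ k, w (φ k) ∈ Set.pi Set.univ fun i => Set.Icc (d i - √B) (d i + √B) := by
    intro k
    refine Set.mem_univ_pi.mpr fun i => ?_
    have h1 : (w (φ k) i - d i) ^ 2 ≤ B := (Finset.single_le_sum
      (f := fun i => (w (φ k) i - d i) ^ 2) (fun _ _ => sq_nonneg _) (Finset.mem_univ i)).trans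
      (hB ⟨φ k, rfl⟩)
    have := abs_le.mp (Real.abs_le_sqrt h1)
    exact ⟨by linarith, by linarith⟩
  obtain ⟨v, -, θ, hθ, hv⟩ := (isCompact_univ_pi fun i =>
    isCompact_Icc (a := d i - √B) (b := d i + √B)).tendsto_subseq hmem
  have hDc : Continuous fun x : Fin n → ℝ => ∑ i, G x i * (d i - x i) := by fun_prop
  have hGv : ∀ i, G v i = 0 := by
    refine hzero d hd v (le_of_tendsto_of_tendsto' ((hDc.tendsto v).comp hv)
      (tendsto_one_div_add_atTop_nhds_zero_nat.comp hθ.tendsto_atTop) fun k => ?_)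
    exact (hφd (θ k)).le
  refine ⟨v, hGv, Metric.tendsto_atTop.mpr fun ε hε => ?_⟩
  -- The constant 8 leaves room for `(x - y) ^ 2 ≤ 2 * x ^ 2 + 2 * y ^ 2`: two errors below `ε ^ 2 /
  -- 8` give less than `ε ^ 2 / 2`.
  obtain ⟨e, hev, heT⟩ : ∃ e, ∑ i, (v i - e i) ^ 2 < ε ^ 2 / 8 ∧ e ∈ T := by
    have hopen : IsOpen {e : Fin n → ℝ | ∑ i, (v i - e i) ^ 2 < ε ^ 2 / 8} :=
      isOpen_lt (by fun_prop) continuous_const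
    exact mem_closure_iff.mp (hT hGv) _ hopen (by
      show ∑ i, (v i - v i) ^ 2 < ε ^ 2 / 8
      have : 0 < ε ^ 2 / 8 := by positivity
      simpa using this)
  obtain ⟨c', hc'⟩ := hconv e heT
  -- The whole sequence of distances to `e` converges, so its limit can be read off along the
  -- subsequence tending to `v`.
  have hlim : Tendsto (fun k => ∑ i, (w k i - e i) ^ 2) atTop (𝓝 (∑ i, (v i - e i) ^ 2)) := by
    have hqc : Continuous fun x : Fin n → ℝ => ∑ i, (x i - e i) ^ 2 := by fun_prop
    have h2 := hc'.comp (hφ.comp hθ).tendsto_atTop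
    rwa [tendsto_nhds_unique h2 ((hqc.tendsto v).comp hv)] at hc'
  obtain ⟨K, hK⟩ := eventually_atTop.mp (hlim.eventually_lt_const hev)
  refine ⟨K, fun k hk => (dist_pi_lt_iff hε).mpr fun i => ?_⟩
  rw [Real.dist_eq]
  refine abs_lt_of_sq_lt_sq ?_ hε.le
  have h1 := (Finset.single_le_sum (f := fun i => (w k i - e i) ^ 2) (fun _ _ => sq_nonneg _)
    (Finset.mem_univ i)).trans_lt (hK k hk)
  have h2 := (Finset.single_le_sum (f := fun i => (v i - e i) ^ 2) (fun _ _ => sq_nonneg _)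
    (Finset.mem_univ i)).trans_lt hev
  nlinarith [sq_nonneg (w k i - e i + (v i - e i)), sq_pos_of_pos hε]

end Convergence

/-- Almost sure convergence of the stochastic supergradient iteration to a zero of the
supergradient. -/
theorem ae_exists_tendsto_costWeights {Ω E : Type*} {mΩ : MeasurableSpace Ω} [MeasurableSpace E]
    {n : ℕ} [NeZero n] {P : Measure Ω} [IsProbabilityMeasure P] {μ : Measure E}
    [IsProbabilityMeasure μ] {C : E → Fin n → ℝ} {a : Fin n → ℝ} {γ : ℕ → ℝ} (hC : Measurable C)
    (hI : ∀ i, Integrable (fun z => C z i) μ)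
    (hT : ∀ i j, i ≠ j → ∀ r : ℝ, μ {z | C z i - C z j = r} = 0) {Z : ℕ → Ω → E}
    (hZ : ∀ k, Measurable (Z k)) (hlaw : ∀ k, P.map (Z k) = μ) (hind : iIndepFun Z P)
    (h0 : ∀ i, 0 < a i) (ha : ∑ i, a i = 1) (hγ : ∀ k, 0 ≤ γ k)
    (hγs : ¬ Summable γ) (hγ2 : Summable fun k => γ k ^ 2) :
    ∀ᵐ ω ∂P, ∃ v, (∀ i, costGrad C a μ v i = 0) ∧
      Tendsto (fun k => costWeights C a γ (fun l => Z l ω) k) atTop (𝓝 v) := by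
  have h1 : ∀ i, a i ≤ 1 := fun i => ha ▸ Finset.single_le_sum (f := a) (fun j _ => (h0 j).le)
    (Finset.mem_univ i)
  have hmax : ∀ d, (∀ i, costGrad C a μ d i = 0) → ∀ v, costDual C a μ v ≤ costDual C a μ d :=
    fun d hd v => by simpa [hd] using costDual_le (a := a) hC hI hT d v
  obtain ⟨w, hw⟩ := exists_costDual_max hC hI hT h0 ha
  -- Countability allows the almost sure events belonging to the points of `T` to be intersected.
  obtain ⟨T, hTS, hTc, hTd⟩ := (TopologicalSpace.IsSeparable.of_separableSpace
    {w | ∀ i, costGrad C a μ w i = 0}).exists_countable_dense_subset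
  have hTne : T.Nonempty :=
    closure_nonempty_iff.mp ⟨w, hTd fun i => costGrad_eq_zero_of_max hC hI hT hw i⟩
  have hpos : ∀ d ∈ T, ∀ w, 0 ≤ ∑ i, costGrad C a μ w i * (d i - w i) := fun d hd w => by
    linarith [costDual_le (a := a) hC hI hT w d, hmax d (hTS hd) w]
  have hzero : ∀ d ∈ T, ∀ w, ∑ i, costGrad C a μ w i * (d i - w i) ≤ 0 →
      ∀ i, costGrad C a μ w i = 0 := fun d hd w hw => by
    refine costGrad_eq_zero_of_max hC hI hT fun v => ?_
    linarith [costDual_le (a := a) hC hI hT w d, hmax d (hTS hd) v]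
  filter_upwards [(ae_ball_iff hTc).mpr fun d hd => ae_tendsto_dist_and_summable hC hT hZ hlaw hind
    (fun i => (h0 i).le) h1 hγ hγ2 (hpos d hd)] with ω hω
  exact exists_tendsto_zero_of_drift (fun i => continuous_costGrad hC hT i) hTne hTd hpos hzero hγ
    hγs (fun d hd => (hω d hd).1) fun d hd => (hω d hd).2

/-! ### Reduction of the robots' algorithm to the abstract iteration. -/

theorem LowerSemicontinuousOn.measurable_indicator {X : Type*} [TopologicalSpace X]
    [MeasurableSpace X] [OpensMeasurableSpace X] {Q : Set X} (hQ : MeasurableSet Q) {c : X → ℝ}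
    (hc : LowerSemicontinuousOn c Q) : Measurable (Q.indicator c) := by
  refine measurable_of_restrict_of_restrict_compl hQ ?_ ?_
  · have h : Q.domRestrict (Q.indicator c) = Q.domRestrict c := by
      ext x; exact Set.indicator_of_mem x.2 c
    rw [h]
    exact (lowerSemicontinuous_restrict_iff.mpr hc).measurable
  · have h : Qᶜ.domRestrict (Q.indicator c) = fun _ => 0 := by
      ext x; exact Set.indicator_of_notMem x.2 c
    rw [h]
    exact measurable_const

/-- On `Q` each cost lies between its lower bound and the integrable maximum; finiteness of `μ`
makes the constant bound integrable. -/
theorem integrable_indicator_of_iSup {X : Type*} [MeasurableSpace X] {μ : Measure X}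
    [IsFiniteMeasure μ] {Q : Set X} (hQ : MeasurableSet Q) {n : ℕ} {c : X → Fin n → ℝ}
    (hm : ∀ i, Measurable (Q.indicator fun z => c z i))
    (hb : ∀ i, BddBelow ((fun z => c z i) '' Q))
    (hs : IntegrableOn (fun z => ⨆ i, c z i) Q μ) (i : Fin n) :
    Integrable (Q.indicator fun z => c z i) μ := by
  obtain ⟨b, hb⟩ := hb i
  refine (((hs.integrable_indicator hQ).abs).add (integrable_const |b|)).mono'
    (hm i).aestronglyMeasurable (Eventually.of_forall fun z => ?_)
  by_cases hz : z ∈ Q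
  · have h1 : c z i ≤ ⨆ i, c z i := le_ciSup (Set.finite_range _).bddAbove i
    have h2 : b ≤ c z i := hb ⟨z, hz, rfl⟩
    simp only [hz, Set.indicator_of_mem, Real.norm_eq_abs, Pi.add_apply]
    exact abs_le.mpr ⟨by linarith [neg_abs_le b, abs_nonneg (⨆ i, c z i)],
      by linarith [le_abs_self (⨆ i, c z i), abs_nonneg b]⟩
  · simp [hz]

/-- The adaptive partitioning algorithm performs the stochastic supergradient iteration. -/
theorem adaptiveWeights_eq_costWeights {q n : ℕ} {N : SimpleGraph (Fin n)} (hN : N.Connected)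
    {rounds : ℕ} (hrounds : N.diam ≤ rounds) {f : ℝ → ℝ} {g : Fin n → EuclideanSpace ℝ (Fin q)}
    {a : Fin n → ℝ} {γ : ℕ → ℝ} {C : EuclideanSpace ℝ (Fin q) → Fin n → ℝ}
    {z : ℕ → EuclideanSpace ℝ (Fin q)} (hz : ∀ k i, C (z k) i = radialCost f (z k) (g i)) (k : ℕ) :
    adaptiveWeights N rounds f g a γ z k = costWeights C a γ z k := by
  induction k with
  | zero => rfl
  | succ k ih =>
    funext i
    simp only [adaptiveWeights, costWeights, floodMin_eq_self_iff N hN hrounds, ih]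
    have hiff : z k ∈ costCell C (costWeights C a γ z k) i ↔
        ∀ j, f ‖z k - g i‖ - costWeights C a γ z k i ≤ f ‖z k - g j‖ - costWeights C a γ z k j :=
      forall_congr' fun j => by rw [hz, hz, radialCost, radialCost]
    split_ifs with h
    · rw [Set.indicator_of_mem (hiff.mpr h)]
    · rw [Set.indicator_of_notMem fun h' => h (hiff.mp h'), sub_zero]

end

theorem mainTheorem3 {Ω : Type*} [MeasurableSpace Ω] (P : Measure Ω) [IsProbabilityMeasure P]
    {q n : ℕ}
    -- the workspace, the distribution of the events, and the events
    (Q : Set (EuclideanSpace ℝ (Fin q))) (hQ : IsCompact Q)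
    (Pz : Measure (EuclideanSpace ℝ (Fin q))) [IsProbabilityMeasure Pz] (hPzQ : Pz Qᶜ = 0)
    (Z : ℕ → Ω → EuclideanSpace ℝ (Fin q)) (hZmeas : ∀ k, Measurable (Z k))
    (hZlaw : ∀ k, P.map (Z k) = Pz) (hZindep : iIndepFun Z P)
    -- the generators and the desired utilization rates
    (g : Fin n → EuclideanSpace ℝ (Fin q)) (hg : Function.Injective g)
    (a : Fin n → ℝ) (ha_pos : ∀ i, 0 < a i) (ha_sum : ∑ i, a i = 1)
    -- the communication network of the robots
    (N : SimpleGraph (Fin n)) (hN : N.Connected) (rounds : ℕ) (hrounds : N.diam ≤ rounds)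
    (f : ℝ → ℝ)
    -- Assumption A1 for the cost `f ‖z - g i‖`
    (hA1_bdd : ∀ i, BddBelow ((fun z => radialCost f z (g i)) '' Q))
    (hA1_lsc : ∀ i, LowerSemicontinuousOn (fun z => radialCost f z (g i)) Q)
    (hA1_int : IntegrableOn (fun z => ⨆ i, radialCost f z (g i)) Q Pz)
    -- Assumption A2
    (hA2 : ∀ i j, i ≠ j → ∀ r : ℝ,
      Pz {z | z ∈ Q ∧ radialCost f z (g i) - radialCost f z (g j) = r} = 0)
    -- the stepsizes
    (γ : ℕ → ℝ) (hγ_nonneg : ∀ k, 0 ≤ γ k)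
    (hγ_sum : Tendsto (fun K => ∑ k ∈ Finset.range K, γ k) atTop atTop)
    (hγ_sq : Summable fun k => γ k ^ 2) :
    ∀ᵐ ω ∂P, ∃ wstar : Fin n → ℝ,
      Tendsto (fun k => adaptiveWeights N rounds f g a γ (fun l => Z l ω) k) atTop (𝓝 wstar) ∧
      IsMaxOn (dualFunction (radialCost f) g a Q Pz) Set.univ wstar ∧
      ∀ i, Pz (genVoronoiCell (radialCost f) g wstar i) = ENNReal.ofReal (a i) := by
  have : NeZero n := ⟨by rintro rfl; simp at ha_sum⟩
  have hQm := hQ.measurableSet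
  have hae : ∀ᵐ z ∂Pz, z ∈ Q := hPzQ
  -- A1 controls the costs only on `Q`. Extending them by zero gives globally measurable costs; the
  -- artificial ties off `Q` are harmless because the complement is null.
  set C : EuclideanSpace ℝ (Fin q) → Fin n → ℝ :=
    fun z i => Q.indicator (fun z => radialCost f z (g i)) z with hCdef
  have hCQ : ∀ z ∈ Q, ∀ i, C z i = radialCost f z (g i) := fun z hz i => Set.indicator_of_mem hz _
  have hCi : ∀ i, Measurable fun z => C z i := fun i => (hA1_lsc i).measurable_indicator hQm
  have hC : Measurable C := measurable_pi_lambda _ hCi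
  have hI : ∀ i, Integrable (fun z => C z i) Pz :=
    integrable_indicator_of_iSup (c := fun z i => radialCost f z (g i)) hQm hCi hA1_bdd hA1_int
  have hT : ∀ i j, i ≠ j → ∀ r : ℝ, Pz {z | C z i - C z j = r} = 0 := by
    intro i j hij r
    refine measure_mono_null
      (t := {z | z ∈ Q ∧ radialCost f z (g i) - radialCost f z (g j) = r} ∪ Qᶜ)
      (fun z hz => ?_) (measure_union_null (hA2 i j hij r) hPzQ)
    by_cases hzQ : z ∈ Q
    · exact Or.inl ⟨hzQ, by rw [← hCQ z hzQ i, ← hCQ z hzQ j]; exact hz⟩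
    · exact Or.inr hzQ
  have hγs : ¬ Summable γ := fun h =>
    not_tendsto_nhds_of_tendsto_atTop hγ_sum _ h.tendsto_sum_tsum_nat
  have hZQ : ∀ᵐ ω ∂P, ∀ k, Z k ω ∈ Q := ae_all_iff.mpr fun k =>
    ae_of_ae_map (hZmeas k).aemeasurable ((hZlaw k).symm ▸ hae)
  have hdual : ∀ w, dualFunction (radialCost f) g a Q Pz w = costDual C a Pz w := by
    intro w
    rw [dualFunction, costDual, Measure.restrict_eq_self_of_ae_mem hae]
    congr 1
    refine integral_congr_ae ?_
    filter_upwards [hae] with z hz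
    simp only [hCQ z hz]
  have hcell : ∀ w i, Pz (genVoronoiCell (radialCost f) g w i) = Pz (costCell C w i) := by
    intro w i
    refine measure_congr ?_
    filter_upwards [hae] with z hz
    refine propext (forall_congr' fun j => ?_)
    rw [hCQ z hz, hCQ z hz]
  filter_upwards [hZQ, ae_exists_tendsto_costWeights hC hI hT hZmeas hZlaw hZindep ha_pos ha_sum
    hγ_nonneg hγs hγ_sq] with ω hω ⟨v, hv, hlim⟩
  refine ⟨v, ?_, fun w _ => ?_, fun i => ?_⟩
  · simpa only [adaptiveWeights_eq_costWeights hN hrounds fun k => hCQ (Z k ω) (hω k)] using hlim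
  · show dualFunction _ _ _ _ _ _ ≤ dualFunction _ _ _ _ _ _
    rw [hdual, hdual]
    simpa [hv] using costDual_le (a := a) hC hI hT v w
  · rw [hcell, ← ofReal_measureReal, ← sub_eq_zero.mp (hv i)]
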